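/- Let $H$ be a complex Hilbert space and let $\mathcal N$ be a complete nest on $H$, i.e. a totally ordered family of orthogonal projections containing $0$ and $I$ that is a complete sublattice of the lattice of projections on $H$. Let $\mathcal T(\mathcal N)=\{T\in B(H): T(PH)\subseteq PH \text{ for all } P\in\mathcal N\}$ be its nest algebra; write $P^\perp=I-P$. A complex subspace $\mathcal M\subseteq B(H)$ is a $\mathcal T(\mathcal N)$-bimodule if $AT,TA\in\mathcal M$, and a Lie $\mathcal T(\mathcal N)$-module if $AT-TA\in\mathcal M$, for all $A\in\mathcal M$, $T\in\mathcal T(\mathcal N)$. "Weakly closed" means closed in the weak operator topology, and $\overline{\operatorname{span}}^{w}$ denotes the closure of the linear span in that topology. For $x,y\in H$ let $x\otimes y$ be the operator $z\mapsto\langle z,x\rangle y$ (with $\langle\cdot,\cdot\rangle$ linear in the first variable), and for $z\in H$ let $$P_z=\bigwedge\{Q\in\mathcal N: Qz=z\},\qquad \hat P_z=\bigvee\{Q\in\mathcal N: Qz=0\}.$$ For a subspace $\mathcal M$ of $B(H)$ put $$\mathcal C(\mathcal M)=\{x\otimes y: x,y\in H,\ P_yB(H)\hat P_x^\perp\subseteq\mathcal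 M\},\qquad \mathcal J(\mathcal M)=\overline{\operatorname{span}}^{w}(\mathcal C(\mathcal M)).$$ (1) If $\mathcal M$ is a weakly closed subspace of $B(H)$, then $\mathcal J(\mathcal M)$ is the largest weakly closed $\mathcal T(\mathcal N)$-bimodule contained in $\mathcal M$. (2) If $\mathcal L$ is a weakly closed Lie $\mathcal T(\mathcal N)$-module, then $\mathcal J(\mathcal L)$ is the largest weakly closed $\mathcal T(\mathcal N)$-bimodule contained in $\mathcal L$, and $$\mathcal J(\mathcal L)=\overline{\operatorname{span}}^{w}\Bigl(\bigcup_{x\otimes y\in\mathcal C(\mathcal L)}P_yB(H)\hat P_x^\perp\Bigr)=\overline{\operatorname{span}}^{w}\Bigl(\bigcup\{QB(H)P^\perp: P,Q\in\mathcal N,\ QB(H)P^\perp\subseteq\mathcal L\}\Bigr).$$ -/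

import Mathlib

namespace NestModules

variable {H : Type*} [NormedAddCommGroup H] [InnerProductSpace ℂ H] [CompleteSpace H]

/-- The orthogonal projection of `H` onto the closure of the subspace `K`. -/
noncomputable def closureProj (K : Submodule ℂ H) : H →L[ℂ] H :=
  K.topologicalClosure.starProjection

/-- The supremum of a set of projections in the lattice of projections on `H`:
the projection onto the closed span of the ranges (so the supremum of `∅` is `0`). -/
noncomputable def projSup (S : Set (H →L[ℂ] H)) : H →L[ℂ] H :=
  closureProj (⨆ P ∈ S, P.range)

/-- The infimum of a set of projections in the lattice of projections on `H`:
the projection onto the intersection of the ranges (so the infimum of `∅` is `1`).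
The intersection is already closed, since ranges of projections are closed. -/
noncomputable def projInf (S : Set (H →L[ℂ] H)) : H →L[ℂ] H :=
  closureProj (⨅ P ∈ S, P.range)

/-- A complete nest on `H`: a totally ordered set of orthogonal projections containing `0` and
the identity, which is a complete sublattice of the lattice of projections. Projections are
ordered by inclusion of their ranges. -/
structure IsCompleteNest (N : Set (H →L[ℂ] H)) : Prop where
  isStarProjection : ∀ P ∈ N, IsStarProjection P
  zero_mem : 0 ∈ N
  one_mem : 1 ∈ N
  total : ∀ P ∈ N, ∀ Q ∈ N, P.range ≤ Q.range ∨ Q.range ≤ P.range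
  projSup_mem : ∀ S ⊆ N, projSup S ∈ N
  projInf_mem : ∀ S ⊆ N, projInf S ∈ N

/-- The nest algebra of `N`: all operators leaving the range of every `P ∈ N` invariant. -/
def nestAlgebra (N : Set (H →L[ℂ] H)) : Subalgebra ℂ (H →L[ℂ] H) where
  carrier := {T | ∀ P ∈ N, ∀ z ∈ P.range, T z ∈ P.range}
  mul_mem' := fun ha hb P hP z hz => ha P hP _ (hb P hP z hz)
  add_mem' := fun ha hb P hP z hz => add_mem (ha P hP z hz) (hb P hP z hz)
  algebraMap_mem' := fun c P _ z hz => by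
    simpa [Algebra.algebraMap_eq_smul_one] using P.range.smul_mem c hz

/-- `M` is a bimodule over the nest algebra of `N`. -/
def IsBimodule (N : Set (H →L[ℂ] H)) (M : Submodule ℂ (H →L[ℂ] H)) : Prop :=
  ∀ A ∈ M, ∀ T ∈ nestAlgebra N, A * T ∈ M ∧ T * A ∈ M

/-- `M` is a Lie module over the nest algebra of `N`. -/
def IsLieModule (N : Set (H →L[ℂ] H)) (M : Submodule ℂ (H →L[ℂ] H)) : Prop :=
  ∀ A ∈ M, ∀ T ∈ nestAlgebra N, A * T - T * A ∈ M

/-- `M` is closed in the weak operator topology. -/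
def IsWeaklyClosed (M : Submodule ℂ (H →L[ℂ] H)) : Prop :=
  IsClosed {A : H →WOT[ℂ] H | A.toCLM ∈ M}

/-- The closure in the weak operator topology of the linear span of `X`. -/
noncomputable def weakSpan (X : Set (H →L[ℂ] H)) : Submodule ℂ (H →L[ℂ] H) :=
  (((Submodule.span ℂ X).comap
    (ContinuousLinearMapWOT.linearEquiv (σ := RingHom.id ℂ) (E := H) (F := H) ℂ).toLinearMap
    ).topologicalClosure).map
    (ContinuousLinearMapWOT.linearEquiv (σ := RingHom.id ℂ) (E := H) (F := H) ℂ).toLinearMap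

/-- The rank one operator `x ⊗ y`, that is `z ↦ ⟨z, x⟩ y` with the inner product linear in
its first argument; Mathlib writes `⟨z, x⟩` as `inner ℂ x z`. -/
noncomputable def tensor (x y : H) : H →L[ℂ] H := InnerProductSpace.rankOne ℂ y x

/-- `P_z = ⋀ {Q ∈ N : Q z = z}`. -/
noncomputable def lowerProj (N : Set (H →L[ℂ] H)) (z : H) : H →L[ℂ] H :=
  projInf {Q ∈ N | Q z = z}

/-- `P̂_z = ⋁ {Q ∈ N : Q z = 0}`. -/
noncomputable def hatProj (N : Set (H →L[ℂ] H)) (z : H) : H →L[ℂ] H :=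
  projSup {Q ∈ N | Q z = 0}

/-- The block `Q B(H) P^⊥`, where `P^⊥ = 1 - P`. -/
def block (Q P : H →L[ℂ] H) : Set (H →L[ℂ] H) :=
  Set.range fun A : H →L[ℂ] H => Q * A * (1 - P)

/-- `C(M) = {x ⊗ y : P_y B(H) P̂_x^⊥ ⊆ M}`. -/
def rankOneSet (N : Set (H →L[ℂ] H)) (M : Submodule ℂ (H →L[ℂ] H)) : Set (H →L[ℂ] H) :=
  {T | ∃ x y : H, T = tensor x y ∧ block (lowerProj N y) (hatProj N x) ⊆ M}

/-- `J(M)`: the weak operator closure of the span of `C(M)`. -/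
noncomputable def bimoduleCore (N : Set (H →L[ℂ] H)) (M : Submodule ℂ (H →L[ℂ] H)) :
    Submodule ℂ (H →L[ℂ] H) :=
  weakSpan (rankOneSet N M)

end NestModules

/-! Everything reduces to rank one operators. By the bipolar theorem
(`mem_weakSpan_of_vectorFunctional`), membership in a weakly closed span is tested by functionals `T
↦ tr(TK)` with `K` of finite rank, and such a trace vanishes once `TK` has no nonzero eigenvalue
(`sum_inner_eq_zero_of_no_eigenvector`). This shows that rank one operators weakly span each block
(`block_subset_weakSpan`) and that those in the nest algebra span the identity weakly
(`one_mem_weakSpan_tensor`).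

A weakly closed bimodule containing `x ⊗ y` contains the block of `y` and `x`: the slices `{v | x ⊗
v ∈ V}` and `{u | u ⊗ v ∈ V}` are closed and invariant under the nest algebra and its adjoints
respectively, hence contain the ranges of `P_y` and `P̂_x^⊥`.

If a weakly closed bimodule `V ⊆ M` contains `A`, then `A (a ⊗ b) = a ⊗ A b` lies in `V` for `a ⊗ b`
in the nest algebra, so its block lies in `M` and `a ⊗ A b ∈ C(M)`. Approximating the identity by
sums of such `a ⊗ b` puts `A` in `J(M)`. -/

namespace NestModules

universe u

variable {H : Type u} [NormedAddCommGroup H] [InnerProductSpace ℂ H]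

/-! ### Traces of finite rank operators -/

/-- A finite rank operator `w ↦ ∑ i, ⟨w, yᵢ⟩ xᵢ` without nonzero eigenvalues has trace zero. -/
lemma sum_inner_eq_zero_of_no_eigenvector {ι : Type*} [Fintype ι] (x y : ι → H)
    (h : ∀ (c : ℂ) (z : H), c ≠ 0 → ∑ i, inner ℂ (y i) z • x i = c • z → z = 0) :
    ∑ i, inner ℂ (y i) (x i) = 0 := by
  classical
  let G : Matrix ι ι ℂ := Matrix.of fun i j => inner ℂ (y i) (x j)
  have htr : ∑ i, inner ℂ (y i) (x i) = G.trace := rfl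
  rw [htr, Matrix.trace_eq_sum_roots_charpoly]
  refine Multiset.sum_eq_zero fun c hc => ?_
  by_contra hc0
  have h1 : c ∈ spectrum ℂ G :=
    Matrix.mem_spectrum_iff_isRoot_charpoly.2 (Polynomial.isRoot_of_mem_roots hc)
  rw [← Matrix.spectrum_toLin', ← Module.End.hasEigenvalue_iff_mem_spectrum] at h1
  obtain ⟨v, hv⟩ := h1.exists_hasEigenvector
  have hv1 : ∀ i, ∑ j, inner ℂ (y i) (x j) * v j = c * v i := fun i =>
    congrFun hv.apply_eq_smul i
  have hv2 : ∀ i, inner ℂ (y i) (∑ j, v j • x j) = c * v i := by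
    intro i
    rw [← hv1, inner_sum]
    exact Finset.sum_congr rfl fun j _ => by rw [inner_smul_right, mul_comm]
  -- An eigenvector `v` of the Gram matrix gives the eigenvector `∑ j, v j • x j` of the operator,
  -- with the same eigenvalue.
  have hz : ∑ j, v j • x j = 0 := by
    refine h c _ hc0 ?_
    simp_rw [hv2, Finset.smul_sum, smul_smul]
  refine hv.2 (funext fun i => ?_)
  have := hv2 i
  rw [hz, inner_zero_right] at this
  simpa [hc0] using this.symm

/-! ### Closed spans in the weak operator topology -/

lemma mem_weakSpan_iff_mem_closure {X : Set (H →L[ℂ] H)} {A : H →L[ℂ] H} :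
    A ∈ weakSpan X ↔ ContinuousLinearMapWOT.ofCLM A ∈
      closure {T : H →WOT[ℂ] H | T.toCLM ∈ Submodule.span ℂ X} := by
  constructor
  · rintro ⟨T, hT, rfl⟩
    exact hT
  · intro h
    exact ⟨ContinuousLinearMapWOT.ofCLM A, h, rfl⟩

lemma isWeaklyClosed_weakSpan (X : Set (H →L[ℂ] H)) : IsWeaklyClosed (weakSpan X) := by
  have h : {A : H →WOT[ℂ] H | A.toCLM ∈ weakSpan X} =
      closure {T : H →WOT[ℂ] H | T.toCLM ∈ Submodule.span ℂ X} := by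
    ext A
    exact mem_weakSpan_iff_mem_closure
  rw [IsWeaklyClosed, h]
  exact isClosed_closure

lemma subset_weakSpan (X : Set (H →L[ℂ] H)) : X ⊆ weakSpan X := fun _ hA =>
  mem_weakSpan_iff_mem_closure.2 (subset_closure (Submodule.subset_span hA))

lemma weakSpan_le {X : Set (H →L[ℂ] H)} {M : Submodule ℂ (H →L[ℂ] H)} (hM : IsWeaklyClosed M)
    (h : X ⊆ M) : weakSpan X ≤ M := by
  intro A hA
  have hs : {T : H →WOT[ℂ] H | T.toCLM ∈ Submodule.span ℂ X} ⊆ {T | T.toCLM ∈ M} :=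
    fun T hT => Submodule.span_le.2 h hT
  exact closure_minimal hs hM (mem_weakSpan_iff_mem_closure.1 hA)

lemma weakSpan_mono {X Y : Set (H →L[ℂ] H)} (h : X ⊆ Y) : weakSpan X ≤ weakSpan Y :=
  weakSpan_le (isWeaklyClosed_weakSpan Y) (h.trans (subset_weakSpan Y))

/-- The functional `T ↦ ∑ i, ⟨T xᵢ, yᵢ⟩`. -/
noncomputable def vectorFunctional {ι : Type*} [Fintype ι] (x y : ι → H) :
    (H →L[ℂ] H) →ₗ[ℂ] ℂ where
  toFun T := ∑ i, inner ℂ (y i) (T (x i))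
  map_add' S T := by simp [Finset.sum_add_distrib]
  map_smul' c T := by simp [Finset.mul_sum]

lemma vectorFunctional_apply {ι : Type*} [Fintype ι] (x y : ι → H) (T : H →L[ℂ] H) :
    vectorFunctional x y T = ∑ i, inner ℂ (y i) (T (x i)) := rfl

lemma isWeaklyClosed_ker_vectorFunctional {ι : Type*} [Fintype ι] (x y : ι → H) :
    IsWeaklyClosed (vectorFunctional x y).ker := by
  have hc : Continuous fun T : H →WOT[ℂ] H => ∑ i, inner ℂ (y i) (T (x i)) :=
    continuous_finsetSum _ fun i _ =>
      ContinuousLinearMapWOT.continuous_dual_apply (x i) (innerSL ℂ (y i))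
  exact isClosed_singleton.preimage hc

lemma vectorFunctional_eq_zero_of_mem_weakSpan {ι : Type*} [Fintype ι] {x y : ι → H}
    {X : Set (H →L[ℂ] H)} (h : ∀ T ∈ X, vectorFunctional x y T = 0) {A : H →L[ℂ] H}
    (hA : A ∈ weakSpan X) : vectorFunctional x y A = 0 :=
  weakSpan_le (isWeaklyClosed_ker_vectorFunctional x y) h hA

/-! ### Rank one operators -/

lemma tensor_apply (x y z : H) : tensor x y z = inner ℂ x z • y := rfl

lemma mul_tensor (T : H →L[ℂ] H) (x y : H) : T * tensor x y = tensor x (T y) := by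
  ext z
  simp [tensor_apply]

lemma IsWeaklyClosed.isClosed {V : Submodule ℂ (H →L[ℂ] H)} (hV : IsWeaklyClosed V) :
    IsClosed (V : Set (H →L[ℂ] H)) := by
  have hc : Continuous (ContinuousLinearMapWOT.ofCLM : (H →L[ℂ] H) → (H →WOT[ℂ] H)) :=
    ContinuousLinearMapWOT.continuous_of_dual_apply_continuous fun x f =>
      f.continuous.comp (ContinuousLinearMap.apply ℂ H x).continuous
  exact hV.preimage hc

/-- The vectors `v` such that `x ⊗ v` belongs to `V`. -/
def rightSlice (V : Submodule ℂ (H →L[ℂ] H)) (x : H) : Submodule ℂ H where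
  carrier := {v | tensor x v ∈ V}
  zero_mem' := by simp [tensor]
  add_mem' := fun {a b} ha hb => by
    have : tensor x (a + b) = tensor x a + tensor x b := by simp [tensor]
    simpa [this] using add_mem ha hb
  smul_mem' := fun c v hv => by
    have : tensor x (c • v) = c • tensor x v := by simp [tensor]
    simpa [this] using V.smul_mem c hv

/-- The vectors `u` such that `u ⊗ y` belongs to `V`. -/
def leftSlice (V : Submodule ℂ (H →L[ℂ] H)) (y : H) : Submodule ℂ H where
  carrier := {u | tensor u y ∈ V}
  zero_mem' := by simp [tensor]
  add_mem' := fun {a b} ha hb => by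
    have : tensor (a + b) y = tensor a y + tensor b y := by simp [tensor]
    simpa [this] using add_mem ha hb
  smul_mem' := fun c v hv => by
    have : tensor (c • v) y = starRingEnd ℂ c • tensor v y := by simp [tensor]
    simpa [this] using V.smul_mem (starRingEnd ℂ c) hv

lemma mem_rightSlice {V : Submodule ℂ (H →L[ℂ] H)} {x v : H} :
    v ∈ rightSlice V x ↔ tensor x v ∈ V := Iff.rfl

lemma mem_leftSlice {V : Submodule ℂ (H →L[ℂ] H)} {y u : H} :
    u ∈ leftSlice V y ↔ tensor u y ∈ V := Iff.rfl

lemma IsWeaklyClosed.isClosed_rightSlice {V : Submodule ℂ (H →L[ℂ] H)} (hV : IsWeaklyClosed V)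
    (x : H) : IsClosed (rightSlice V x : Set H) := by
  have hc : Continuous fun v : H => tensor x v := by unfold tensor; fun_prop
  exact hV.isClosed.preimage hc

lemma IsWeaklyClosed.isClosed_leftSlice {V : Submodule ℂ (H →L[ℂ] H)} (hV : IsWeaklyClosed V)
    (y : H) : IsClosed (leftSlice V y : Set H) := by
  have hc : Continuous fun u : H => tensor u y := by unfold tensor; fun_prop
  exact hV.isClosed.preimage hc

variable [CompleteSpace H]

/-- The bipolar theorem for subspaces in the weak operator topology. -/
lemma mem_weakSpan_of_vectorFunctional {X : Set (H →L[ℂ] H)} {A : H →L[ℂ] H}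
    (h : ∀ (ι : Type u) [Fintype ι] (x y : ι → H),
      (∀ T ∈ X, vectorFunctional x y T = 0) → vectorFunctional x y A = 0) :
    A ∈ weakSpan X := by
  classical
  rw [mem_weakSpan_iff_mem_closure,
    ContinuousLinearMapWOT.isInducing_inducingFn.closure_eq_preimage_closure_image]
  rw [Set.mem_preimage, mem_closure_iff]
  intro O hO hAO
  obtain ⟨I, U, hU, hIU⟩ := isOpen_pi_iff.1 hO _ hAO
  let Φ : (H →L[ℂ] H) →ₗ[ℂ] (I → ℂ) :=
    { toFun := fun T p => p.1.2 (T p.1.1)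
      map_add' := fun S T => by ext; simp
      map_smul' := fun c T => by ext; simp }
  -- A basic neighbourhood sees only finitely many coordinates, so separation takes place in `ℂ^I`;
  -- by Riesz the separating functional is a vector functional.
  have key : Φ A ∈ (Submodule.span ℂ X).map Φ := by
    by_contra hn
    obtain ⟨f, hf, hle⟩ := Submodule.exists_le_ker_of_notMem hn
    have hf' : ∀ T : H →L[ℂ] H, f (Φ T) = vectorFunctional (fun p : I => p.1.1)
        (fun p : I => (starRingEnd ℂ (f (Pi.single p 1))) •
          (InnerProductSpace.toDual ℂ H).symm p.1.2) T := by
      intro T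
      rw [LinearMap.pi_apply_eq_sum_univ f, vectorFunctional_apply]
      refine Finset.sum_congr rfl fun p _ => ?_
      rw [inner_smul_left, InnerProductSpace.toDual_symm_apply, smul_eq_mul, mul_comm,
        Complex.conj_conj]
      congr 2
      ext j
      simp [Pi.single_apply, eq_comm]
    refine hf ?_
    rw [hf']
    refine h _ _ _ fun T hT => ?_
    rw [← hf']
    exact hle (Submodule.mem_map_of_mem (Submodule.subset_span hT))
  obtain ⟨T, hT, hTA⟩ := key
  refine ⟨_, hIU ?_, ⟨ContinuousLinearMapWOT.ofCLM T, hT, rfl⟩⟩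
  intro p hp
  have h1 : p.2 (T p.1) = p.2 (A p.1) := congrFun hTA ⟨p, hp⟩
  have h2 := (hU p hp).2
  change p.2 (T p.1) ∈ U p
  rw [h1]
  exact h2

/-- Since `⟨BTCx, y⟩ = ⟨T(Cx), B*y⟩`, vector functionals pull back to vector functionals under `T ↦
BTC`. -/
lemma weakSpan_mul_mem {X : Set (H →L[ℂ] H)} {V : Submodule ℂ (H →L[ℂ] H)}
    (hV : IsWeaklyClosed V) {B C : H →L[ℂ] H} (h : ∀ T ∈ X, B * T * C ∈ V) {A : H →L[ℂ] H}
    (hA : A ∈ weakSpan X) : B * A * C ∈ V := by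
  refine weakSpan_le hV (subset_refl _) (mem_weakSpan_of_vectorFunctional fun ι _ x y hxy => ?_)
  have e : ∀ T : H →L[ℂ] H, vectorFunctional x y (B * T * C) =
      vectorFunctional (fun i => C (x i)) (fun i => ContinuousLinearMap.adjoint B (y i)) T := by
    intro T
    simp [vectorFunctional_apply, ContinuousLinearMap.adjoint_inner_left]
  rw [e]
  refine vectorFunctional_eq_zero_of_mem_weakSpan (fun T hT => ?_) hA
  rw [← e]
  exact hxy _ (h T hT)

lemma tensor_mul (T : H →L[ℂ] H) (x y : H) :
    tensor x y * T = tensor (ContinuousLinearMap.adjoint T x) y := by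
  ext z
  simp [tensor_apply, ContinuousLinearMap.adjoint_inner_left]

lemma adjoint_tensor_apply (x y z : H) :
    ContinuousLinearMap.adjoint (tensor x y) z = inner ℂ y z • x := by
  simp [tensor]

/-! ### Projections -/

lemma mem_range_iff_of_isStarProjection {P : H →L[ℂ] H} (hP : IsStarProjection P) {z : H} :
    z ∈ P.range ↔ P z = z := by
  constructor
  · rintro ⟨w, rfl⟩
    exact congrArg (fun T : H →L[ℂ] H => T w) hP.isIdempotentElem.eq
  · exact fun h => ⟨z, h⟩

lemma inner_apply_of_isStarProjection {P : H →L[ℂ] H} (hP : IsStarProjection P) (a b : H) :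
    inner ℂ (P a) b = inner ℂ a (P b) := by
  conv_lhs => rw [← ContinuousLinearMap.isSelfAdjoint_iff'.1 hP.isSelfAdjoint]
  exact ContinuousLinearMap.adjoint_inner_left P b a

lemma isClosed_range_of_isStarProjection {P : H →L[ℂ] H} (hP : IsStarProjection P) :
    IsClosed (P.range : Set H) := by
  have h : (P.range : Set H) = {z | P z = z} :=
    Set.ext fun z => mem_range_iff_of_isStarProjection hP
  rw [h]
  exact isClosed_eq P.continuous continuous_id

lemma mem_orthogonal_range_iff {P : H →L[ℂ] H} (hP : IsStarProjection P) {z : H} :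
    z ∈ P.rangeᗮ ↔ P z = 0 := by
  rw [Submodule.mem_orthogonal]
  constructor
  · intro h
    refine ext_inner_left ℂ fun w => ?_
    rw [← inner_apply_of_isStarProjection hP, inner_zero_right]
    exact h _ ⟨w, rfl⟩
  · rintro h _ ⟨w, rfl⟩
    change inner ℂ (P w) z = 0
    rw [inner_apply_of_isStarProjection hP, h, inner_zero_right]

lemma apply_eq_zero_of_range_le {P Q : H →L[ℂ] H} (hP : IsStarProjection P)
    (hQ : IsStarProjection Q) (h : P.range ≤ Q.range) {z : H} (hz : Q z = 0) : P z = 0 :=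
  (mem_orthogonal_range_iff hP).1
    (Submodule.orthogonal_le h ((mem_orthogonal_range_iff hQ).2 hz))

lemma apply_eq_self_of_range_le {P Q : H →L[ℂ] H} (hP : IsStarProjection P)
    (hQ : IsStarProjection Q) (h : P.range ≤ Q.range) {z : H} (hz : P z = z) : Q z = z :=
  (mem_range_iff_of_isStarProjection hQ).1 (h ((mem_range_iff_of_isStarProjection hP).2 hz))

lemma apply_sub_apply_self {P : H →L[ℂ] H} (hP : IsStarProjection P) (z : H) :
    P (z - P z) = 0 := by
  have h : P (P z) = P z := (mem_range_iff_of_isStarProjection hP).1 ⟨z, rfl⟩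
  rw [map_sub, h, sub_self]

lemma inner_sub_apply_self_ne_zero {P : H →L[ℂ] H} (hP : IsStarProjection P) {z : H}
    (hz : P z ≠ z) : inner ℂ (z - P z) z ≠ 0 := by
  have h : inner ℂ (z - P z) (P z) = 0 := by
    rw [← inner_apply_of_isStarProjection hP, apply_sub_apply_self hP, inner_zero_left]
  have h2 : inner ℂ (z - P z) z = inner ℂ (z - P z) (z - P z) := by
    conv_rhs => rw [inner_sub_right, h, sub_zero]
  rw [h2, inner_self_ne_zero]
  exact sub_ne_zero.2 hz.symm

lemma inner_apply_self_ne_zero {P : H →L[ℂ] H} (hP : IsStarProjection P) {z : H}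
    (hz : P z ≠ 0) : inner ℂ (P z) z ≠ 0 := by
  have h : P (P z) = P z := (mem_range_iff_of_isStarProjection hP).1 ⟨z, rfl⟩
  rw [← h, inner_apply_of_isStarProjection hP, inner_self_ne_zero]
  exact hz

lemma range_projSup (S : Set (H →L[ℂ] H)) :
    (projSup S).range = (⨆ P ∈ S, P.range).topologicalClosure :=
  Submodule.range_starProjection _

lemma range_le_range_projSup {S : Set (H →L[ℂ] H)} {P : H →L[ℂ] H} (hP : P ∈ S) :
    P.range ≤ (projSup S).range := by
  rw [range_projSup]
  exact (le_iSup₂_of_le P hP le_rfl).trans (Submodule.le_topologicalClosure (⨆ P ∈ S, P.range))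

lemma range_projSup_le {S : Set (H →L[ℂ] H)} {W : Submodule ℂ H} (hW : IsClosed (W : Set H))
    (h : ∀ P ∈ S, P.range ≤ W) : (projSup S).range ≤ W := by
  rw [range_projSup]
  exact Submodule.topologicalClosure_minimal _ (iSup₂_le h) hW

lemma range_projInf {S : Set (H →L[ℂ] H)} (hS : ∀ P ∈ S, IsStarProjection P) :
    (projInf S).range = ⨅ P ∈ S, P.range := by
  have h : IsClosed ((⨅ P ∈ S, P.range : Submodule ℂ H) : Set H) := by
    simp only [Submodule.coe_iInf]
    exact isClosed_iInter fun P => isClosed_iInter fun hP =>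
      isClosed_range_of_isStarProjection (hS P hP)
  rw [projInf, closureProj]
  refine (Submodule.range_starProjection _).trans ?_
  exact h.submodule_topologicalClosure_eq

lemma orthogonal_range_projInf_le {S : Set (H →L[ℂ] H)} (hS : ∀ P ∈ S, IsStarProjection P)
    {W : Submodule ℂ H} (hW : IsClosed (W : Set H)) (h : ∀ P ∈ S, P.rangeᗮ ≤ W) :
    (projInf S).rangeᗮ ≤ W := by
  have hW2 : Wᗮᗮ = W := by
    rw [Submodule.orthogonal_orthogonal_eq_closure, hW.submodule_topologicalClosure_eq]
  rw [← hW2]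
  refine Submodule.orthogonal_le ?_
  rw [range_projInf hS]
  refine le_iInf₂ fun P hP => ?_
  have hc : P.rangeᗮᗮ = P.range := by
    rw [Submodule.orthogonal_orthogonal_eq_closure,
      (isClosed_range_of_isStarProjection (hS P hP)).submodule_topologicalClosure_eq]
  rw [← hc]
  exact Submodule.orthogonal_le (h P hP)

/-! ### Blocks -/

lemma tensor_mem_block {P Q : H →L[ℂ] H} (hP : IsStarProjection P) {x y : H} (hx : P x = 0)
    (hy : Q y = y) : tensor x y ∈ block Q P := by
  refine ⟨tensor x y, ?_⟩
  ext z
  simp [tensor_apply, hy, ← inner_apply_of_isStarProjection hP, hx]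

/-- If `tr(·K)` kills the rank one operators of the block, then `(1 - P)KQ = 0`, so `tr(QB(1 - P)K)
= tr(B(1 - P)KQ) = 0`. -/
lemma block_subset_weakSpan {P Q : H →L[ℂ] H} (hP : IsStarProjection P)
    (hQ : IsStarProjection Q) :
    block Q P ⊆ weakSpan {T | ∃ u v, T = tensor u v ∧ P u = 0 ∧ Q v = v} := by
  rintro _ ⟨B, rfl⟩
  refine mem_weakSpan_of_vectorFunctional fun ι _ x y hxy => ?_
  have key : ∀ w : H, ∑ i, inner ℂ (Q (y i)) w • (x i - P (x i)) = 0 := by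
    intro w
    refine ext_inner_left ℂ fun a => ?_
    have h := hxy _ ⟨a - P a, Q w, rfl, apply_sub_apply_self hP a,
      (mem_range_iff_of_isStarProjection hQ).1 ⟨w, rfl⟩⟩
    rw [vectorFunctional_apply] at h
    rw [inner_zero_right, inner_sum, ← h]
    refine Finset.sum_congr rfl fun i _ => ?_
    rw [tensor_apply, inner_smul_right, inner_smul_right, inner_sub_left, inner_sub_right,
      inner_apply_of_isStarProjection hP, inner_apply_of_isStarProjection hQ, mul_comm]
  have hs : vectorFunctional x y (Q * B * (1 - P)) =
      ∑ i, inner ℂ (Q (y i)) (B (x i - P (x i))) := by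
    rw [vectorFunctional_apply]
    refine Finset.sum_congr rfl fun i _ => ?_
    rw [inner_apply_of_isStarProjection hQ]
    rfl
  rw [hs]
  refine sum_inner_eq_zero_of_no_eigenvector (fun i => B (x i - P (x i))) (fun i => Q (y i))
    fun c z hc hz => ?_
  have h0 : ∑ i, inner ℂ (Q (y i)) z • B (x i - P (x i)) = 0 := by
    have := congrArg B (key z)
    simpa only [map_sum, map_smul, map_zero] using this
  rw [h0] at hz
  exact (smul_eq_zero.1 hz.symm).resolve_left hc

variable {N : Set (H →L[ℂ] H)}

/-! ### Nests -/

namespace IsCompleteNest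

lemma lowerProj_mem (hN : IsCompleteNest N) (z : H) : lowerProj N z ∈ N :=
  hN.projInf_mem _ fun _ h => h.1

lemma hatProj_mem (hN : IsCompleteNest N) (z : H) : hatProj N z ∈ N :=
  hN.projSup_mem _ fun _ h => h.1

lemma range_lowerProj_le (hN : IsCompleteNest N) {Q : H →L[ℂ] H} (hQ : Q ∈ N) {z : H}
    (hz : Q z = z) : (lowerProj N z).range ≤ Q.range := by
  rw [lowerProj, range_projInf fun P hP => hN.isStarProjection P hP.1]
  exact iInf₂_le Q ⟨hQ, hz⟩

lemma lowerProj_apply (hN : IsCompleteNest N) (z : H) : lowerProj N z z = z := by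
  rw [← mem_range_iff_of_isStarProjection (hN.isStarProjection _ (hN.lowerProj_mem z)), lowerProj,
    range_projInf fun P hP => hN.isStarProjection P hP.1]
  simp only [Submodule.mem_iInf]
  exact fun P hP => ⟨z, hP.2⟩

lemma range_le_hatProj {Q : H →L[ℂ] H} (hQ : Q ∈ N) {z : H} (hz : Q z = 0) :
    Q.range ≤ (hatProj N z).range := range_le_range_projSup ⟨hQ, hz⟩

lemma hatProj_apply (hN : IsCompleteNest N) (z : H) : hatProj N z z = 0 := by
  have hz : (hatProj N z).range ≤ (ℂ ∙ z)ᗮ := by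
    refine range_projSup_le (Submodule.isClosed_orthogonal _) fun P hP v hv => ?_
    rw [Submodule.mem_orthogonal_singleton_iff_inner_right]
    exact (Submodule.mem_orthogonal' _ _).1
      ((mem_orthogonal_range_iff (hN.isStarProjection P hP.1)).2 hP.2) v hv
  rw [← mem_orthogonal_range_iff (hN.isStarProjection _ (hN.hatProj_mem z)),
    Submodule.mem_orthogonal']
  exact fun v hv => Submodule.mem_orthogonal_singleton_iff_inner_right.1 (hz hv)

end IsCompleteNest

lemma apply_of_mem_nestAlgebra (hN : IsCompleteNest N) {T Q : H →L[ℂ] H}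
    (hT : T ∈ nestAlgebra N) (hQ : Q ∈ N) {z : H} (hz : Q z = z) : Q (T z) = T z :=
  (mem_range_iff_of_isStarProjection (hN.isStarProjection Q hQ)).1 (hT Q hQ z ⟨z, hz⟩)

lemma apply_adjoint_of_mem_nestAlgebra (hN : IsCompleteNest N) {T Q : H →L[ℂ] H}
    (hT : T ∈ nestAlgebra N) (hQ : Q ∈ N) {z : H} (hz : Q z = 0) :
    Q (ContinuousLinearMap.adjoint T z) = 0 := by
  have hs := hN.isStarProjection Q hQ
  rw [← mem_orthogonal_range_iff hs, Submodule.mem_orthogonal] at hz ⊢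
  intro w hw
  rw [ContinuousLinearMap.adjoint_inner_right]
  exact hz _ (hT Q hQ w hw)

lemma tensor_mem_nestAlgebra (hN : IsCompleteNest N) {a b : H}
    (h : ∀ Q ∈ N, Q a = 0 ∨ Q b = b) : tensor a b ∈ nestAlgebra N := by
  intro Q hQ z hz
  rw [tensor_apply]
  rcases h Q hQ with ha | hb
  · have h0 := (mem_orthogonal_range_iff (hN.isStarProjection Q hQ)).2 ha
    rw [(Submodule.mem_orthogonal' _ _).1 h0 z hz, zero_smul]
    exact zero_mem _
  · exact Q.range.smul_mem _ ⟨b, hb⟩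

lemma tensor_mem_nestAlgebra_of_mem (hN : IsCompleteNest N) {P : H →L[ℂ] H} (hP : P ∈ N)
    {a b : H} (ha : P a = 0) (hb : P b = b) : tensor a b ∈ nestAlgebra N := by
  refine tensor_mem_nestAlgebra hN fun Q hQ => ?_
  rcases hN.total P hP Q hQ with h | h
  · exact .inr (apply_eq_self_of_range_le (hN.isStarProjection P hP)
      (hN.isStarProjection Q hQ) h hb)
  · exact .inl (apply_eq_zero_of_range_le (hN.isStarProjection Q hQ)
      (hN.isStarProjection P hP) h ha)

/-- The supremum of the projections of the nest which do not fix `z`. -/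
noncomputable def predProj (N : Set (H →L[ℂ] H)) (z : H) : H →L[ℂ] H :=
  projSup {Q ∈ N | Q z ≠ z}

lemma predProj_mem (hN : IsCompleteNest N) (z : H) : predProj N z ∈ N :=
  hN.projSup_mem _ fun _ h => h.1

/-- Each member of the nest either fixes `z`, hence dominates `P_z`, or lies below `predProj N z`.
-/
lemma tensor_mem_nestAlgebra_of_predProj (hN : IsCompleteNest N) {z a b : H}
    (ha : predProj N z a = 0) (hb : lowerProj N z b = b) : tensor a b ∈ nestAlgebra N := by
  refine tensor_mem_nestAlgebra hN fun Q hQ => ?_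
  by_cases hQz : Q z = z
  · exact .inr (apply_eq_self_of_range_le (hN.isStarProjection _ (hN.lowerProj_mem z))
      (hN.isStarProjection Q hQ) (hN.range_lowerProj_le hQ hQz) hb)
  · exact .inl (apply_eq_zero_of_range_le (hN.isStarProjection Q hQ)
      (hN.isStarProjection _ (predProj_mem hN z)) (range_le_range_projSup ⟨hQ, hQz⟩) ha)

/-- The infimum of the projections of the nest which do not annihilate `z`. -/
noncomputable def succProj (N : Set (H →L[ℂ] H)) (z : H) : H →L[ℂ] H :=
  projInf {Q ∈ N | Q z ≠ 0}

lemma succProj_mem (hN : IsCompleteNest N) (z : H) : succProj N z ∈ N :=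
  hN.projInf_mem _ fun _ h => h.1

lemma tensor_mem_nestAlgebra_of_succProj (hN : IsCompleteNest N) {z a b : H}
    (ha : hatProj N z a = 0) (hb : succProj N z b = b) : tensor a b ∈ nestAlgebra N := by
  refine tensor_mem_nestAlgebra hN fun Q hQ => ?_
  by_cases hQz : Q z = 0
  · exact .inl (apply_eq_zero_of_range_le (hN.isStarProjection Q hQ)
      (hN.isStarProjection _ (hN.hatProj_mem z)) (IsCompleteNest.range_le_hatProj hQ hQz) ha)
  · refine .inr (apply_eq_self_of_range_le (hN.isStarProjection _ (succProj_mem hN z))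
      (hN.isStarProjection Q hQ) ?_ hb)
    rw [succProj, range_projInf fun P hP => hN.isStarProjection P hP.1]
    exact iInf₂_le Q ⟨hQ, hQz⟩

/-! ### Invariant subspaces of a nest algebra and of its adjoint -/

/-- An operator `a ⊗ v` of the nest algebra with `⟨y, a⟩ ≠ 0` sends `y` to a nonzero multiple of
`v`. Taking `a = y - Qy` reaches the range of every `Q` not fixing `y`, hence of their supremum. If
that supremum does not fix `y`, it serves as `Q` itself and reaches all of `P_y`. -/
lemma range_lowerProj_le_of_invariant (hN : IsCompleteNest N) {W : Submodule ℂ H}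
    (hW : IsClosed (W : Set H)) (hT : ∀ T ∈ nestAlgebra N, ∀ v ∈ W, T v ∈ W) {y : H}
    (hy : y ∈ W) : (lowerProj N y).range ≤ W := by
  have hfix : ∀ a v, inner ℂ a y ≠ 0 → tensor a v ∈ nestAlgebra N → v ∈ W := by
    intro a v h0 ht
    have h1 := hT _ ht y hy
    rw [tensor_apply] at h1
    exact (W.smul_mem_iff h0).1 h1
  have hpred : (predProj N y).range ≤ W := by
    refine range_projSup_le hW fun Q hQ v hv => ?_
    have hs := hN.isStarProjection Q hQ.1
    exact hfix _ v (inner_sub_apply_self_ne_zero hs hQ.2) (tensor_mem_nestAlgebra_of_mem hN hQ.1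
      (apply_sub_apply_self hs y) ((mem_range_iff_of_isStarProjection hs).1 hv))
  by_cases hp : predProj N y y = y
  · exact (hN.range_lowerProj_le (predProj_mem hN y) hp).trans hpred
  · have hs := hN.isStarProjection _ (predProj_mem hN y)
    intro v hv
    exact hfix _ v (inner_sub_apply_self_ne_zero hs hp) (tensor_mem_nestAlgebra_of_predProj hN
      (apply_sub_apply_self hs y) ((mem_range_iff_of_isStarProjection
        (hN.isStarProjection _ (hN.lowerProj_mem y))).1 hv))

/-- Dual argument: the adjoint of `u ⊗ b` sends `x` to a multiple of `u`, with `b = Qx` for `Q` not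
annihilating `x`, and the infimum of these `Q` replaces the supremum. -/
lemma orthogonal_range_hatProj_le_of_invariant (hN : IsCompleteNest N) {W : Submodule ℂ H}
    (hW : IsClosed (W : Set H))
    (hT : ∀ T ∈ nestAlgebra N, ∀ v ∈ W, ContinuousLinearMap.adjoint T v ∈ W) {x : H}
    (hx : x ∈ W) : (hatProj N x).rangeᗮ ≤ W := by
  have hfix : ∀ u b, inner ℂ b x ≠ 0 → tensor u b ∈ nestAlgebra N → u ∈ W := by
    intro u b h0 ht
    have h1 := hT _ ht x hx
    rw [adjoint_tensor_apply] at h1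
    exact (W.smul_mem_iff h0).1 h1
  have hsucc : (succProj N x).rangeᗮ ≤ W := by
    refine orthogonal_range_projInf_le (fun P hP => hN.isStarProjection P hP.1) hW
      fun Q hQ u hu => ?_
    have hs := hN.isStarProjection Q hQ.1
    exact hfix u _ (inner_apply_self_ne_zero hs hQ.2) (tensor_mem_nestAlgebra_of_mem hN hQ.1
      ((mem_orthogonal_range_iff hs).1 hu) ((mem_range_iff_of_isStarProjection hs).1 ⟨x, rfl⟩))
  by_cases hp : succProj N x x = 0
  · exact (Submodule.orthogonal_le
      (IsCompleteNest.range_le_hatProj (succProj_mem hN x) hp)).trans hsucc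
  · have hs := hN.isStarProjection _ (succProj_mem hN x)
    intro u hu
    exact hfix u _ (inner_apply_self_ne_zero hs hp) (tensor_mem_nestAlgebra_of_succProj hN
      ((mem_orthogonal_range_iff (hN.isStarProjection _ (hN.hatProj_mem x))).1 hu)
      ((mem_range_iff_of_isStarProjection hs).1 ⟨x, rfl⟩))

/-- A weakly closed bimodule containing `x ⊗ y` contains the block `P_y B(H) P̂_x^⊥`. -/
lemma block_subset_of_tensor_mem (hN : IsCompleteNest N) {V : Submodule ℂ (H →L[ℂ] H)}
    (hV : IsBimodule N V) (hVc : IsWeaklyClosed V) {x y : H} (h : tensor x y ∈ V) :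
    block (lowerProj N y) (hatProj N x) ⊆ V := by
  have hP := hN.isStarProjection _ (hN.hatProj_mem x)
  have hQ := hN.isStarProjection _ (hN.lowerProj_mem y)
  refine (block_subset_weakSpan hP hQ).trans (weakSpan_le hVc ?_)
  rintro _ ⟨u, v, rfl, hu, hv⟩
  -- One leg moves at a time: `y` to `v` with `x` fixed, then `x` to `u` with `v` fixed.
  have h1 : v ∈ rightSlice V x := by
    refine range_lowerProj_le_of_invariant hN (hVc.isClosed_rightSlice x) (fun T hT w hw => ?_)
      (mem_rightSlice.2 h) ((mem_range_iff_of_isStarProjection hQ).2 hv)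
    rw [mem_rightSlice, ← mul_tensor]
    exact (hV _ hw T hT).2
  have h2 : u ∈ leftSlice V v := by
    refine orthogonal_range_hatProj_le_of_invariant hN (hVc.isClosed_leftSlice v)
      (fun T hT w hw => ?_) (mem_leftSlice.2 h1) ((mem_orthogonal_range_iff hP).2 hu)
    rw [mem_leftSlice, ← tensor_mul]
    exact (hV _ hw T hT).1
  exact h2

/-! ### Density of the rank one operators of a nest algebra -/

/-- The identity is in the weakly closed span of the rank one operators of the nest algebra. -/
theorem one_mem_weakSpan_tensor (hN : IsCompleteNest N) :
    1 ∈ weakSpan {T | ∃ a b, T = tensor a b ∧ tensor a b ∈ nestAlgebra N} := by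
  refine mem_weakSpan_of_vectorFunctional fun ι _ x y hxy => ?_
  refine sum_inner_eq_zero_of_no_eigenvector x y fun c z hc hz => ?_
  by_contra hz0
  let K : H →L[ℂ] H := ∑ i, tensor (y i) (x i)
  have hK : ∀ w, K w = ∑ i, inner ℂ (y i) w • x i := by
    intro w
    simp [K, tensor_apply]
  have hKz : K z = c • z := (hK z).trans hz
  have horth : ∀ a b, tensor a b ∈ nestAlgebra N → inner ℂ a (K b) = 0 := by
    intro a b hab
    have h := hxy _ ⟨a, b, rfl, hab⟩
    rw [hK, inner_sum, ← h, vectorFunctional_apply]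
    refine Finset.sum_congr rfl fun i _ => ?_
    rw [tensor_apply, inner_smul_right, inner_smul_right, mul_comm]
  have hmem : ∀ P : H →L[ℂ] H, IsStarProjection P → ∀ b, (∀ a, P a = 0 →
      tensor a b ∈ nestAlgebra N) → K b ∈ P.range := by
    intro P hP b h
    have hc : P.rangeᗮᗮ = P.range := by
      rw [Submodule.orthogonal_orthogonal_eq_closure,
        (isClosed_range_of_isStarProjection hP).submodule_topologicalClosure_eq]
    rw [← hc, Submodule.mem_orthogonal]
    exact fun a ha => horth a b (h a ((mem_orthogonal_range_iff hP).1 ha))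
  have hs := hN.isStarProjection _ (predProj_mem hN z)
  by_cases hp : predProj N z z = z
  -- When `z` is only a limit of the projections not fixing it, finite rank of `K` lets a single
  -- such projection `Q` do the work.
  · have hfin : FiniteDimensional ℂ K.range := by
      have hle : K.range ≤ Submodule.span ℂ (Set.range x) := by
        rintro _ ⟨w, rfl⟩
        change K w ∈ _
        rw [hK]
        exact Submodule.sum_mem _ fun i _ =>
          Submodule.smul_mem _ _ (Submodule.subset_span ⟨i, rfl⟩)
      have := FiniteDimensional.span_of_finite ℂ (Set.finite_range x)
      exact Submodule.finiteDimensional_of_le hle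
    let S : Set (H →L[ℂ] H) := {Q ∈ N | Q z ≠ z}
    let F : (H →L[ℂ] H) → Submodule ℂ K.range := fun Q => Q.range.map K.toLinearMap.rangeRestrict
    have hne : (F '' S).Nonempty := ⟨_, 0, ⟨hN.zero_mem, fun h => hz0 h.symm⟩, rfl⟩
    -- The images under `K` of the ranges form a chain in a finite-dimensional space, so one is
    -- largest.
    obtain ⟨_, ⟨Q, hQ, rfl⟩, hmax⟩ :=
      (wellFounded_gt (α := Submodule ℂ K.range)).has_min (F '' S) hne
    have hFle : ∀ R ∈ S, F R ≤ F Q := by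
      intro R hR
      rcases hN.total R hR.1 Q hQ.1 with h | h
      · exact Submodule.map_mono h
      · exact (eq_of_le_of_not_lt (Submodule.map_mono h) (hmax _ ⟨R, hR, rfl⟩)).ge
    let E : Submodule ℂ H := (F Q).map K.range.subtype
    have : FiniteDimensional ℂ E := inferInstance
    -- Closedness carries the inclusion over to the supremum, giving `K z = K w` with `w` in the
    -- range of `Q`. As `K` preserves that range, it contains `c • z`, a contradiction.
    have hEc : IsClosed ((E.comap K.toLinearMap : Submodule ℂ H) : Set H) :=
      E.closed_of_finiteDimensional.preimage K.continuous
    have hle : (predProj N z).range ≤ E.comap K.toLinearMap := by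
      refine range_projSup_le hEc fun R hR w hw => ?_
      exact ⟨_, hFle R hR ⟨w, hw, rfl⟩, rfl⟩
    obtain ⟨_, ⟨w, hw, rfl⟩, hwz⟩ := hle ((mem_range_iff_of_isStarProjection hs).2 hp)
    have hwz' : K w = K z := hwz
    have hQs := hN.isStarProjection Q hQ.1
    have hKw : K w ∈ Q.range := hmem Q hQs w fun a ha =>
      tensor_mem_nestAlgebra_of_mem hN hQ.1 ha ((mem_range_iff_of_isStarProjection hQs).1 hw)
    rw [hwz', hKz, Submodule.smul_mem_iff _ hc, mem_range_iff_of_isStarProjection hQs] at hKw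
    exact hQ.2 hKw
  · have hKw : K z ∈ (predProj N z).range := hmem _ hs z fun a ha =>
      tensor_mem_nestAlgebra_of_predProj hN ha (hN.lowerProj_apply z)
    rw [hKz, Submodule.smul_mem_iff _ hc, mem_range_iff_of_isStarProjection hs] at hKw
    exact hp hKw

/-! ### The largest bimodule in a weakly closed space -/

lemma block_mono (hN : IsCompleteNest N) {P Q P' Q' : H →L[ℂ] H} (hP : P ∈ N) (hQ : Q ∈ N)
    (hP' : P' ∈ N) (hQ' : Q' ∈ N) (hPP : P'.range ≤ P.range) (hQQ : Q.range ≤ Q'.range) :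
    block Q P ⊆ block Q' P' := by
  rintro _ ⟨A, rfl⟩
  refine ⟨Q * A * (1 - P), ?_⟩
  ext z
  have h1 : P (P' z) = P' z := apply_eq_self_of_range_le (hN.isStarProjection _ hP')
    (hN.isStarProjection _ hP) hPP ((mem_range_iff_of_isStarProjection
      (hN.isStarProjection _ hP')).1 ⟨z, rfl⟩)
  have h2 : ∀ w, Q' (Q w) = Q w := fun w => apply_eq_self_of_range_le (hN.isStarProjection _ hQ)
    (hN.isStarProjection _ hQ') hQQ ((mem_range_iff_of_isStarProjection
      (hN.isStarProjection _ hQ)).1 ⟨w, rfl⟩)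
  simp [h1, h2]

/-- The block attached to `u ⊗ v` is the smallest nest block containing it, so any nest block inside
`M` may certify membership. -/
lemma tensor_mem_rankOneSet_of_block_subset (hN : IsCompleteNest N)
    {M : Submodule ℂ (H →L[ℂ] H)} {P Q : H →L[ℂ] H} (hP : P ∈ N) (hQ : Q ∈ N)
    (h : block Q P ⊆ M) {u v : H} (hu : P u = 0) (hv : Q v = v) :
    tensor u v ∈ rankOneSet N M :=
  ⟨u, v, rfl, (block_mono hN (hN.hatProj_mem u) (hN.lowerProj_mem v) hP hQ
    (IsCompleteNest.range_le_hatProj hP hu) (hN.range_lowerProj_le hQ hv)).trans h⟩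

lemma block_subset_bimoduleCore (hN : IsCompleteNest N) {M : Submodule ℂ (H →L[ℂ] H)}
    {P Q : H →L[ℂ] H} (hP : P ∈ N) (hQ : Q ∈ N) (h : block Q P ⊆ M) :
    block Q P ⊆ bimoduleCore N M := by
  refine (block_subset_weakSpan (hN.isStarProjection P hP) (hN.isStarProjection Q hQ)).trans
    (weakSpan_mono ?_)
  rintro _ ⟨u, v, rfl, hu, hv⟩
  exact tensor_mem_rankOneSet_of_block_subset hN hP hQ h hu hv

lemma tensor_mem_block_self (hN : IsCompleteNest N) (x y : H) :
    tensor x y ∈ block (lowerProj N y) (hatProj N x) :=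
  tensor_mem_block (hN.isStarProjection _ (hN.hatProj_mem x)) (hN.hatProj_apply x)
    (hN.lowerProj_apply y)

lemma bimoduleCore_le (hN : IsCompleteNest N) {M : Submodule ℂ (H →L[ℂ] H)}
    (hM : IsWeaklyClosed M) : bimoduleCore N M ≤ M := by
  refine weakSpan_le hM ?_
  rintro _ ⟨x, y, rfl, h⟩
  exact h (tensor_mem_block_self hN x y)

lemma isBimodule_bimoduleCore (hN : IsCompleteNest N) (M : Submodule ℂ (H →L[ℂ] H)) :
    IsBimodule N (bimoduleCore N M) := by
  intro A hA T hT
  have hc : IsWeaklyClosed (bimoduleCore N M) := isWeaklyClosed_weakSpan _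
  constructor
  · rw [← one_mul A]
    refine weakSpan_mul_mem hc ?_ hA
    rintro _ ⟨x, y, rfl, h⟩
    rw [one_mul, tensor_mul]
    exact subset_weakSpan _ (tensor_mem_rankOneSet_of_block_subset hN (hN.hatProj_mem x)
      (hN.lowerProj_mem y) h
      (apply_adjoint_of_mem_nestAlgebra hN hT (hN.hatProj_mem x) (hN.hatProj_apply x))
      (hN.lowerProj_apply y))
  · rw [← mul_one (T * A)]
    refine weakSpan_mul_mem hc ?_ hA
    rintro _ ⟨x, y, rfl, h⟩
    rw [mul_one, mul_tensor]
    exact subset_weakSpan _ (tensor_mem_rankOneSet_of_block_subset hN (hN.hatProj_mem x)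
      (hN.lowerProj_mem y) h (hN.hatProj_apply x)
      (apply_of_mem_nestAlgebra hN hT (hN.lowerProj_mem y) (hN.lowerProj_apply y)))

lemma le_bimoduleCore (hN : IsCompleteNest N) {V M : Submodule ℂ (H →L[ℂ] H)}
    (hV : IsBimodule N V) (hVc : IsWeaklyClosed V) (hVM : V ≤ M) : V ≤ bimoduleCore N M := by
  intro A hA
  -- The middle factor is the identity to be approximated by rank one operators; the last only fits
  -- the shape `B * T * C`.
  have h : A * 1 * 1 ∈ bimoduleCore N M := by
    refine weakSpan_mul_mem (isWeaklyClosed_weakSpan _) ?_ (one_mem_weakSpan_tensor hN)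
    rintro _ ⟨a, b, rfl, hab⟩
    have h1 : tensor a (A b) ∈ V := by
      rw [← mul_tensor]
      exact (hV A hA _ hab).1
    rw [mul_one, mul_tensor]
    exact subset_weakSpan _
      ⟨a, A b, rfl, (block_subset_of_tensor_mem hN hV hVc h1).trans hVM⟩
  simpa using h

/-- `J(M)` is the largest weakly closed bimodule contained in `M`. -/
theorem isGreatest_bimoduleCore (hN : IsCompleteNest N) {M : Submodule ℂ (H →L[ℂ] H)}
    (hM : IsWeaklyClosed M) :
    IsGreatest {V : Submodule ℂ (H →L[ℂ] H) | IsBimodule N V ∧ IsWeaklyClosed V ∧ V ≤ M}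
      (bimoduleCore N M) :=
  ⟨⟨isBimodule_bimoduleCore hN M, isWeaklyClosed_weakSpan _, bimoduleCore_le hN hM⟩,
    fun _ hV => le_bimoduleCore hN hV.1 hV.2.1 hV.2.2⟩

lemma bimoduleCore_eq_weakSpan_block (hN : IsCompleteNest N) (M : Submodule ℂ (H →L[ℂ] H)) :
    bimoduleCore N M =
      weakSpan {T | ∃ P ∈ N, ∃ Q ∈ N, block Q P ⊆ (M : Set (H →L[ℂ] H)) ∧ T ∈ block Q P} := by
  refine le_antisymm (weakSpan_mono ?_) (weakSpan_le (isWeaklyClosed_weakSpan _) ?_)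
  · rintro _ ⟨x, y, rfl, h⟩
    exact ⟨_, hN.hatProj_mem x, _, hN.lowerProj_mem y, h, tensor_mem_block_self hN x y⟩
  · rintro T ⟨P, hP, Q, hQ, h, hT⟩
    exact block_subset_bimoduleCore hN hP hQ h hT

lemma bimoduleCore_eq_weakSpan_block_rankOneSet (hN : IsCompleteNest N)
    (M : Submodule ℂ (H →L[ℂ] H)) :
    bimoduleCore N M = weakSpan {T | ∃ x y : H, tensor x y ∈ rankOneSet N M ∧
      T ∈ block (lowerProj N y) (hatProj N x)} := by
  refine le_antisymm (weakSpan_mono ?_) (weakSpan_le (isWeaklyClosed_weakSpan _) ?_)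
  · rintro _ ⟨x, y, rfl, h⟩
    exact ⟨x, y, ⟨x, y, rfl, h⟩, tensor_mem_block_self hN x y⟩
  · rintro T ⟨x, y, hxy, hT⟩
    exact block_subset_of_tensor_mem hN (isBimodule_bimoduleCore hN M)
      (isWeaklyClosed_weakSpan _) (subset_weakSpan _ hxy) hT

end NestModules

theorem corollary2 {H : Type*} [NormedAddCommGroup H] [InnerProductSpace ℂ H] [CompleteSpace H]
    (N : Set (H →L[ℂ] H)) (hN : NestModules.IsCompleteNest N) :
    (∀ M : Submodule ℂ (H →L[ℂ] H), NestModules.IsWeaklyClosed M →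
      IsGreatest {V : Submodule ℂ (H →L[ℂ] H) |
          NestModules.IsBimodule N V ∧ NestModules.IsWeaklyClosed V ∧ V ≤ M}
        (NestModules.bimoduleCore N M)) ∧
    (∀ L : Submodule ℂ (H →L[ℂ] H), NestModules.IsWeaklyClosed L → NestModules.IsLieModule N L →
      IsGreatest {V : Submodule ℂ (H →L[ℂ] H) |
          NestModules.IsBimodule N V ∧ NestModules.IsWeaklyClosed V ∧ V ≤ L}
        (NestModules.bimoduleCore N L) ∧
      NestModules.bimoduleCore N L = NestModules.weakSpan
        {T | ∃ x y : H, NestModules.tensor x y ∈ NestModules.rankOneSet N L ∧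
          T ∈ NestModules.block (NestModules.lowerProj N y) (NestModules.hatProj N x)} ∧
      NestModules.bimoduleCore N L = NestModules.weakSpan
        {T | ∃ P ∈ N, ∃ Q ∈ N, NestModules.block Q P ⊆ (L : Set (H →L[ℂ] H)) ∧
          T ∈ NestModules.block Q P}) :=
  ⟨fun _ hM => NestModules.isGreatest_bimoduleCore hN hM, fun L hL _ =>
    ⟨NestModules.isGreatest_bimoduleCore hN hL,
      NestModules.bimoduleCore_eq_weakSpan_block_rankOneSet hN L,
      NestModules.bimoduleCore_eq_weakSpan_block hN L⟩⟩
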